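/- **Setting.** A robust MDP (RMDP) $\mathcal M=(\mathcal S,\mathcal A,\mathcal P)$ has a finite state set $\mathcal S$, a finite nonempty action set $\mathcal A$, a nonempty set $\mathcal A(s)\subseteq\mathcal A$ of available actions at each state $s$, and for each $s$ and $a\in\mathcal A(s)$ a nonempty compact set $\mathcal P(s,a)$ of probability distributions on $\mathcal S$. An agent policy $\sigma$ maps each history $s_0,a_0,\dots,s_{i-1},a_{i-1}$ and current state $s_i$ to a distribution on $\mathcal A(s_i)$; an environment policy $\rho$ maps a history, the current state $s$ and an action $a\in\mathcal A(s)$ to an element of $\mathcal P(s,a)$. Write $\mathbb P^{\sigma,\rho}_{\mathcal M}(s)$ for the resulting probability measure on runs $s_0,a_0,s_1,a_1,\dots$ with $s_0=s$. For $T\subseteq\mathcal S$ let $\mathit{Reach}(T)$ be the set of runs with $s_i\in T$ for some $i$, and put $\mathit{Val}^{s,\sigma}_{\mathcal M}=\inf_\rho \mathbb P^{\sigma,\rho}_{\mathcal M}(s)[\mathit{Reach}(T)]$ and $\mathit{Val}^{s}_{\mathcal M}=\sup_\sigma \mathit{Val}^{s,\sigma}_{\mathcal M}$. A policy is memoryless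 if it does not depend on the history, and pure if it always chooses one action with probability $1$. **Oracles and algorithm.** The oracle $\mathit{force}^{\mathcal M}_{\mathscr A}(s,B)$ answers whether $\exists a\in\mathcal A(s)\,\forall\delta\in\mathcal P(s,a)\colon\delta[B]>0$, and $\mathit{force}^{\mathcal M}_{\mathscr E}(s,B)$ whether $\forall a\in\mathcal A(s)\,\exists\delta\in\mathcal P(s,a)\colon\delta[B]>0$; they are available for $\mathcal M$ and for the RMDPs derived from it below. For $X\in\{\mathscr A,\mathscr E\}$ the procedure $\mathit{PAttr}_X(\mathcal M,U)$ puts $T_0=U$ and computes $T_i=T_{i-1}\cup\{s\in\mathcal S\mid \mathit{force}^{\mathcal M}_X(s,T_{i-1})\}$, with one oracle call per state, until $T_i=T_{i-1}$, and returns $T_i$. The RMDP $\mathcal M\setminus Z$ has the states $\mathcal S\setminus Z$, at each of them the actions $a\in\mathcal A(s)$ with $\delta[Z]=0$ for all $\delta\in\mathcal P(s,a)$, and the same uncertainty sets for these. $\mathit{ASReach}(\mathcal M,T)$ repeats $$B=\mathcal S\setminus\mathit{PAttr}_{\mathscr A}(\mathcal M,T),\qquad Z=\mathit{PAttr}_{\mathscr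 E}(\mathcal M,B),\qquad \mathcal M:=\mathcal M\setminus Z$$ (with $\mathcal S$ the state set of the current $\mathcal M$, and $T$ intersected with it) until $B=\varnothing$, and then returns the current state set. Let $\mathcal M^T$ be $\mathcal M$ with every target state made absorbing, i.e. with $\mathcal P(t,a)$ replaced by the Dirac distribution at $t$ for all $t\in T$ and $a\in\mathcal A(t)$. **Theorem.** There is an absolute constant $C$ such that for every RMDP $\mathcal M=(\mathcal S,\mathcal A,\mathcal P)$ and every target set $T\subseteq\mathcal S$ the following hold. 1. (Correctness) Every $s\in\mathit{ASReach}(\mathcal M,T)$ has $\mathit{Val}^{s}_{\mathcal M}=1$. If for every $t\in T$ there is $a\in\mathcal A(t)$ with $\delta[T]=1$ for all $\delta\in\mathcal P(t,a)$ (in particular, if the target states are absorbing), then for all $s\in\mathcal S$: $\mathit{Val}^{s}_{\mathcal M}=1$ if and only if $s\in\mathit{ASReach}(\mathcal M,T)$. For arbitrary $T$ and all $s\in\mathcal S$: $\mathit{Val}^{s}_{\mathcal M}=1$ if and only if $s\in\mathit{ASReach}(\mathcal M^T,T)$. 2. (Oracle complexity) $\mathit{ASReach}(\mathcal M,T)$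 and $\mathit{ASReach}(\mathcal M^T,T)$ always terminate after at most $C|\mathcal S|^3$ oracle calls. 3. (Almost-sure versus limit-sure) There is a pure memoryless agent policy $\sigma^*$ such that for all $s\in\mathcal S$: $\mathit{Val}^{s}_{\mathcal M}=1$ if and only if $\mathit{Val}^{s,\sigma^*}_{\mathcal M}=1$. -/

import Mathlib

open MeasureTheory ProbabilityTheory

noncomputable section

/-- The probability `δ[B]` of sampling an element of `B` from the distribution `δ`. -/
def distMass {S : Type*} (δ : PMF S) (B : Finset S) : ENNReal := ∑ t ∈ B, δ t

/-- A robust MDP. Its state space is the finite set `states`, a subset of an ambient type `S`, so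
that sub-RMDPs live over the same ambient type. `avail s` are the actions available at `s`, and
`unc s a` is the uncertainty set at `(s, a)`, a nonempty compact set of distributions over the
state space. Only the values at states of `states` and at actions available there matter. -/
structure RMDP (S A : Type*) where
  states : Finset S
  avail : S → Finset A
  unc : S → A → Set (PMF S)
  unc_nonempty : ∀ s ∈ states, ∀ a ∈ avail s, (unc s a).Nonempty
  /-- the distributions are distributions over the state space -/
  unc_support : ∀ s ∈ states, ∀ a ∈ avail s, ∀ δ ∈ unc s a, ∀ t ∉ states, δ t = 0
  /-- each uncertainty set is compact as a set of real vectors of probabilities -/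
  unc_compact : ∀ s ∈ states, ∀ a ∈ avail s,
    IsCompact ((fun (δ : PMF S) (t : S) => (δ t).toReal) '' unc s a)

namespace RMDP

/-! ### Policies, runs and values -/

/-- A history `s₀, a₀, …, s_{i-1}, a_{i-1}`, in chronological order. -/
abbrev History (S A : Type*) := List (S × A)

/-- A run `s₀, a₀, s₁, a₁, …`. -/
abbrev Run (S A : Type*) := ℕ → S × A

variable {S A : Type*}

/-- Every state has an available action. -/
def DeadlockFree (M : RMDP S A) : Prop := ∀ s ∈ M.states, (M.avail s).Nonempty

/-- A (randomized, history-dependent) agent policy: it plays only available actions. -/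
structure AgentPolicy (M : RMDP S A) where
  act : History S A → S → PMF A
  act_avail : ∀ h, ∀ s ∈ M.states, ∀ a, act h s a ≠ 0 → a ∈ M.avail s

/-- A (history-dependent) environment policy: having seen the action of the agent, it picks a
distribution in the uncertainty set. -/
structure EnvPolicy (M : RMDP S A) where
  choose : History S A → S → A → PMF S
  choose_mem : ∀ h, ∀ s ∈ M.states, ∀ a ∈ M.avail s, choose h s a ∈ M.unc s a

/-- The policy does not depend on the history. -/
def AgentPolicy.Memoryless {M : RMDP S A} (σ : M.AgentPolicy) : Prop :=
  ∀ h₁ h₂, ∀ s ∈ M.states, σ.act h₁ s = σ.act h₂ s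

/-- The policy always plays a single action with probability one. -/
def AgentPolicy.Pure {M : RMDP S A} (σ : M.AgentPolicy) : Prop :=
  ∀ h, ∀ s ∈ M.states, ∃ a, σ.act h s = PMF.pure a

/-- The distribution of `(s_{n+1}, a_{n+1})` given `(s₀, a₀), …, (sₙ, aₙ)`: the environment's
distribution for `s_{n+1}` followed by the agent's distribution for `a_{n+1}`. -/
def stepPMF {M : RMDP S A} (σ : M.AgentPolicy) (ρ : M.EnvPolicy) (n : ℕ)
    (x : (i : Finset.Iic n) → S × A) : PMF (S × A) :=
  let hist : History S A := List.ofFn fun i : Fin n => x ⟨i, Finset.mem_Iic.2 i.2.le⟩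
  let last : S × A := x ⟨n, Finset.mem_Iic.2 le_rfl⟩
  (ρ.choose hist last.1 last.2).bind fun s' =>
    (σ.act (hist ++ [last]) s').map fun a' => (s', a')

section Measure

variable [Fintype S] [Fintype A] [MeasurableSpace S] [MeasurableSingletonClass S]
  [MeasurableSpace A] [MeasurableSingletonClass A]

/-- `stepPMF` as a Markov kernel from `(s₀, a₀), …, (sₙ, aₙ)` to `(s_{n+1}, a_{n+1})`. -/
def stepKernel {M : RMDP S A} (σ : M.AgentPolicy) (ρ : M.EnvPolicy) (n : ℕ) :
    Kernel ((i : Finset.Iic n) → S × A) (S × A) :=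
  Kernel.ofFunOfCountable fun x => (stepPMF σ ρ n x).toMeasure

instance {M : RMDP S A} (σ : M.AgentPolicy) (ρ : M.EnvPolicy) (n : ℕ) :
    IsMarkovKernel (stepKernel σ ρ n) :=
  ⟨fun x => PMF.toMeasure.isProbabilityMeasure (stepPMF σ ρ n x)⟩

/-- The probability measure on runs from `s₀` under the policies `σ` and `ρ`, obtained from the
one-step kernels by the Ionescu-Tulcea theorem (i.e. from the probabilities of cylinder sets). -/
def runMeasure {M : RMDP S A} (σ : M.AgentPolicy) (ρ : M.EnvPolicy) (s₀ : S) :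
    Measure (Run S A) :=
  Kernel.trajMeasure (X := fun _ => S × A)
    ((σ.act [] s₀).map fun a => (s₀, a)).toMeasure (fun n => stepKernel σ ρ n)

/-- The value of an agent policy at `s₀` for the objective `O`. -/
def valPolicy {M : RMDP S A} (σ : M.AgentPolicy) (O : Set (Run S A)) (s₀ : S) : ENNReal :=
  ⨅ ρ : M.EnvPolicy, runMeasure σ ρ s₀ O

/-- The value of the RMDP at `s₀` for the objective `O`. -/
def val (M : RMDP S A) (O : Set (Run S A)) (s₀ : S) : ENNReal :=
  ⨆ σ : M.AgentPolicy, valPolicy σ O s₀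

end Measure

/-- The reachability objective: runs that visit `T`. -/
def reach (A : Type*) {S : Type*} (T : Finset S) : Set (Run S A) :=
  {ω | ∃ i, (ω i).1 ∈ T}

/-! ### Operations on RMDPs -/

open scoped Classical in
/-- The RMDP `M ∖ B`: the states of `B` are removed, together with all actions that can cause `B`
to be reached in one step. (The remaining distributions vanish on `B`, so projecting them on the
remaining states does not change them as distributions on the ambient type.) -/
def remove (M : RMDP S A) (B : Finset S) : RMDP S A where
  states := M.states \ B
  avail s := (M.avail s).filter fun a => ∀ δ ∈ M.unc s a, distMass δ B = 0
  unc := M.unc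
  unc_nonempty s hs a ha :=
    M.unc_nonempty s (Finset.mem_sdiff.1 hs).1 a (Finset.mem_filter.1 ha).1
  unc_support s hs a ha δ hδ t ht := by
    by_cases htM : t ∈ M.states
    · have htB : t ∈ B := by
        by_contra h
        exact ht (Finset.mem_sdiff.2 ⟨htM, h⟩)
      exact Finset.sum_eq_zero_iff.1 ((Finset.mem_filter.1 ha).2 δ hδ) t htB
    · exact M.unc_support s (Finset.mem_sdiff.1 hs).1 a (Finset.mem_filter.1 ha).1 δ hδ t htM
  unc_compact s hs a ha :=
    M.unc_compact s (Finset.mem_sdiff.1 hs).1 a (Finset.mem_filter.1 ha).1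

open scoped Classical in
/-- The RMDP obtained from `M` by making every state of `T` absorbing. -/
def makeAbsorbing (M : RMDP S A) (T : Finset S) : RMDP S A where
  states := M.states
  avail := M.avail
  unc s a := if s ∈ T then {PMF.pure s} else M.unc s a
  unc_nonempty s hs a ha := by
    split_ifs
    · exact Set.singleton_nonempty _
    · exact M.unc_nonempty s hs a ha
  unc_support s hs a ha δ hδ t ht := by
    split_ifs at hδ
    · rw [Set.mem_singleton_iff.1 hδ]
      exact PMF.pure_apply_of_ne _ _ fun h => ht (h ▸ hs)
    · exact M.unc_support s hs a ha δ hδ t ht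
  unc_compact s hs a ha := by
    split_ifs
    · rw [Set.image_singleton]
      exact isCompact_singleton
    · exact M.unc_compact s hs a ha

/-- In every state of `T` the agent has an action after which the next state is in `T` with
probability one, whatever the environment chooses. Holds if the states of `T` are absorbing. -/
def CanStayIn (M : RMDP S A) (T : Finset S) : Prop :=
  ∀ t ∈ T, ∃ a ∈ M.avail t, ∀ δ ∈ M.unc t a, distMass δ T = 1

/-! ### The oracles -/

/-- `force_A(s, B)`: the agent can force a positive probability of `B` in the next step. -/
def forceA (M : RMDP S A) (s : S) (B : Finset S) : Prop :=
  ∃ a ∈ M.avail s, ∀ δ ∈ M.unc s a, 0 < distMass δ B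

/-- `force_E(s, B)`: the environment can force a positive probability of `B` in the next step. -/
def forceE (M : RMDP S A) (s : S) (B : Finset S) : Prop :=
  ∀ a ∈ M.avail s, ∃ δ ∈ M.unc s a, 0 < distMass δ B

end RMDP

/-! ### Oracle algorithms -/

/-- A possibly non-terminating computation with oracle access. It is undefined if it does not
terminate, and otherwise gives its result together with the number of oracle calls made. -/
abbrev OracleComp (α : Type*) := Part (α × ℕ)

namespace OracleComp

variable {α β S : Type*}

/-- The computation terminates with result `a` after exactly `n` oracle calls. -/
def Returns (x : OracleComp α) (a : α) (n : ℕ) : Prop := (a, n) ∈ x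

/-- Return a value without calling an oracle. -/
def ret (a : α) : OracleComp α := Part.some (a, 0)

/-- Sequential composition; the numbers of calls add up. -/
def andThen (x : OracleComp α) (f : α → OracleComp β) : OracleComp β :=
  Part.bind x fun p => (f p.1).map fun q => (q.1, p.2 + q.2)

open scoped Classical in
/-- One oracle call, with the truth value of `p` as its answer. -/
def query (p : Prop) : OracleComp Bool := Part.some (decide p, 1)

open scoped Classical in
/-- Run the test `f` on each element of `X`, one after the other, and return the set of elements
that pass. -/
def select (X : Finset S) (f : S → OracleComp Bool) : OracleComp (Finset S) :=
  X.toList.foldr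
    (fun s acc => andThen (f s) fun b => andThen acc fun F => ret (if b then insert s F else F))
    (ret ∅)

/-- One pass through a loop with body `body`; the second component accumulates the number of
calls made so far. -/
def loopStep (body : α → OracleComp (β ⊕ α)) : α × ℕ →. (β × ℕ) ⊕ (α × ℕ) := fun p =>
  (body p.1).map fun q => Sum.map (fun b => (b, p.2 + q.2)) (fun a' => (a', p.2 + q.2)) q.1

/-- The loop that runs `body` on the current value until it exits with a result (`Sum.inl`);
otherwise (`Sum.inr`) it goes on with the new value. Undefined if the loop runs forever. -/
def repeatUntil (body : α → OracleComp (β ⊕ α)) (a : α) : OracleComp β :=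
  PFun.fix (loopStep body) (a, 0)

end OracleComp

namespace RMDP

open OracleComp

variable {S A : Type*}

open scoped Classical in
/-- The common loop of the two attractor procedures, for an oracle `force`:
`T₀ = T` and `T_i = T_{i-1} ∪ {s | force(s, T_{i-1})}`, until `T_i = T_{i-1}`. -/
def attrLoop (M : RMDP S A) (force : S → Finset S → Prop) (T : Finset S) :
    OracleComp (Finset S) :=
  repeatUntil (fun T' =>
    andThen (select M.states fun s => query (force s T')) fun F =>
      ret (if T' ∪ F = T' then Sum.inl (T' ∪ F) else Sum.inr (T' ∪ F))) T

/-- The positive attractor of the agent. -/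
def pAttrA (M : RMDP S A) (T : Finset S) : OracleComp (Finset S) := attrLoop M M.forceA T

/-- The positive attractor of the environment. -/
def pAttrE (M : RMDP S A) (T : Finset S) : OracleComp (Finset S) := attrLoop M M.forceE T

open scoped Classical in
/-- The algorithm `ASReach(M, T)`: repeat `B = S ∖ PAttr_A(M, T)`, `Z = PAttr_E(M, B)`,
`M = M ∖ Z` until `B = ∅`, and return the remaining states. (In the current RMDP the target is the
set of target states that have not been removed.) -/
def asReach (M : RMDP S A) (T : Finset S) : OracleComp (Finset S) :=
  repeatUntil (fun N : RMDP S A =>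
    andThen (pAttrA N (T ∩ N.states)) fun P =>
      let B := N.states \ P
      andThen (pAttrE N B) fun Z =>
        let N' := N.remove Z
        ret (if B = ∅ then Sum.inl N'.states else Sum.inr N')) M

end RMDP

end

/-! The value at a state is decided by one of two potential functions, built layer by layer along
the attractors.

On the returned set, every state lies in the agent's positive attractor of `T` inside the final
sub-RMDP. Giving later layers small enough weights yields a potential `u` with values in (0, 1]
whose expectation at least doubles off `T` (`AttrCert.union`, where compactness enters). Then `1 -
u` contracts by a factor below one until `T` is hit, so one pure memoryless policy reaches `T`
almost surely against every environment (`AgentCert.exists_policy`).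

On the removed states there is a weight `w ≤ 1`, positive exactly there and zero on `T`, that a
memoryless environment keeps from decreasing in expectation (`EnvCert.union`). Hence every agent
policy misses `T` with probability at least `w s₀`, and the value itself is below one
(`EnvCert.val_lt_one`). This uniform bound makes limit-sure and almost-sure reachability coincide.

The second certificate needs `CanStayIn`, which prevents targets from being removed. `makeAbsorbing`
provides it, and both certificates transfer back to `M` because they constrain only states off `T`.
-/

noncomputable section

/-! ### Drift criteria for reaching `T` along random runs -/

namespace RMDP

variable {S A : Type*}

/-- The runs that avoid `T` up to time `n`. -/
def avoidUpTo (A : Type*) (T : Finset S) (n : ℕ) : Set (Run S A) :=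
  {ω | ∀ i ≤ n, (ω i).1 ∉ T}

theorem compl_reach_eq_iInter (T : Finset S) : (reach A T)ᶜ = ⋂ n, avoidUpTo A T n := by
  ext ω
  simp only [reach, avoidUpTo, Set.mem_compl_iff, Set.mem_ofPred_eq, Set.mem_iInter, not_exists]
  exact ⟨fun h n i _ => h i, fun h i => h i i le_rfl⟩

theorem antitone_avoidUpTo (T : Finset S) : Antitone (avoidUpTo A T) :=
  fun _ _ hmn _ h i hi => h i (hi.trans hmn)

theorem sum_bind_mul {X Y : Type*} [Fintype X] [Fintype Y] (p : PMF X) (q : X → PMF Y)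
    (g : Y → ENNReal) : ∑ y, (p.bind q) y * g y = ∑ x, p x * ∑ y, q x y * g y := by
  simp_rw [PMF.bind_apply, tsum_fintype, Finset.sum_mul, Finset.mul_sum, mul_assoc]
  exact Finset.sum_comm

theorem sum_pure_mul {X : Type*} [Fintype X] (x : X) (g : X → ENNReal) :
    ∑ y, (PMF.pure x) y * g y = g x := by
  classical
  simp [PMF.pure_apply]

theorem sum_map_mul {X Y : Type*} [Fintype X] [Fintype Y] (p : PMF X) (f : X → Y)
    (g : Y → ENNReal) : ∑ y, (p.map f) y * g y = ∑ x, p x * g (f x) := by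
  rw [PMF.map, sum_bind_mul]
  exact Finset.sum_congr rfl fun x _ => congrArg _ (sum_pure_mul _ _)

/-- The histories are left existential: the drift conditions below are imposed for all histories, so
their exact form is irrelevant. -/
theorem sum_stepPMF_mul [Fintype S] [Fintype A] {M : RMDP S A} (σ : M.AgentPolicy)
    (ρ : M.EnvPolicy) (n : ℕ) (x : (i : Finset.Iic n) → S × A)
    (g : S × A → ENNReal) :
    ∃ h h' : History S A, ∑ z, stepPMF σ ρ n x z * g z =
      ∑ s, ρ.choose h (x ⟨n, Finset.mem_Iic.2 le_rfl⟩).1 (x ⟨n, Finset.mem_Iic.2 le_rfl⟩).2 s *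
        ∑ a, σ.act h' s a * g (s, a) := by
  refine ⟨List.ofFn fun i : Fin n => x ⟨i, Finset.mem_Iic.2 i.2.le⟩,
    (List.ofFn fun i : Fin n => x ⟨i, Finset.mem_Iic.2 i.2.le⟩) ++
      [x ⟨n, Finset.mem_Iic.2 le_rfl⟩], ?_⟩
  simp only [stepPMF]
  rw [sum_bind_mul]
  simp_rw [sum_map_mul]

variable [Fintype S] [Fintype A] [MeasurableSpace S] [MeasurableSingletonClass S]
  [MeasurableSpace A] [MeasurableSingletonClass A]

theorem lintegral_toMeasure_eq_sum {X : Type*} [Fintype X] [MeasurableSpace X]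
    [MeasurableSingletonClass X] (p : PMF X) (g : X → ENNReal) :
    ∫⁻ x, g x ∂p.toMeasure = ∑ x, p x * g x := by
  rw [lintegral_fintype]
  exact Finset.sum_congr rfl fun x _ => by
    rw [PMF.toMeasure_apply_singleton _ _ (measurableSet_singleton x), mul_comm]

variable {M : RMDP S A} (σ : M.AgentPolicy) (ρ : M.EnvPolicy) (s₀ : S) (T : Finset S)

instance : IsProbabilityMeasure (runMeasure σ ρ s₀) := by
  unfold runMeasure
  infer_instance

/-- The Ionescu-Tulcea property: the joint law of a prefix and the next step is the
composition-product of the prefix law with the step kernel. -/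
theorem lintegral_runMeasure_succ (n : ℕ)
    (F : ((i : Finset.Iic n) → S × A) → S × A → ENNReal) :
    ∫⁻ ω, F (Preorder.frestrictLe n ω) (ω (n + 1)) ∂runMeasure σ ρ s₀ =
      ∫⁻ ω, ∑ z, stepPMF σ ρ n (Preorder.frestrictLe n ω) z * F (Preorder.frestrictLe n ω) z
        ∂runMeasure σ ρ s₀ := by
  have hF : Measurable (Function.uncurry F) := measurable_of_countable _
  have key := congrArg (fun ν => ∫⁻ p, Function.uncurry F p ∂ν)
    (Kernel.map_frestrictLe_trajMeasure_compProd_eq_map_trajMeasure (X := fun _ => S × A)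
      (μ₀ := ((σ.act [] s₀).map fun a => (s₀, a)).toMeasure)
      (κ := fun n => stepKernel σ ρ n) (a := n))
  beta_reduce at key
  rw [lintegral_map hF (by fun_prop), Measure.lintegral_compProd hF,
    lintegral_map (measurable_of_countable _) (by fun_prop)] at key
  refine key.symm.trans (lintegral_congr fun ω => ?_)
  exact lintegral_toMeasure_eq_sum _ _

theorem lintegral_runMeasure_zero (g : S × A → ENNReal) :
    ∫⁻ ω, g (ω 0) ∂runMeasure σ ρ s₀ = ∑ a, σ.act [] s₀ a * g (s₀, a) := by
  have hmap : (runMeasure σ ρ s₀).map (fun ω => ω 0) =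
      ((σ.act [] s₀).map fun a => (s₀, a)).toMeasure := by
    have h1 : (fun ω : Run S A => ω 0) =
        (fun x : (i : Finset.Iic 0) → S × A => x ⟨0, Finset.mem_Iic.2 le_rfl⟩) ∘
          Preorder.frestrictLe (π := fun _ => S × A) 0 := rfl
    rw [h1, ← Measure.map_map (by fun_prop) (by fun_prop), runMeasure, Kernel.trajMeasure,
      Measure.map_comp _ _ (by fun_prop), Kernel.traj_map_frestrictLe, Kernel.partialTraj_self,
      Measure.id_comp, Measure.map_map (by fun_prop) (by fun_prop)]
    convert! Measure.map_id
  have h2 : ∫⁻ ω, g (ω 0) ∂runMeasure σ ρ s₀ =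
      ∫⁻ z, g z ∂((runMeasure σ ρ s₀).map (fun ω => ω 0)) :=
    (lintegral_map (measurable_of_countable g) (by fun_prop)).symm
  rw [h2, hmap, lintegral_toMeasure_eq_sum, sum_map_mul]

theorem measurableSet_avoidUpTo (n : ℕ) : MeasurableSet (avoidUpTo A T n) := by
  have : avoidUpTo A T n = ⋂ i, ⋂ (_ : i ≤ n), (fun ω : Run S A => ω i) ⁻¹' {z | z.1 ∉ T} := by
    ext ω
    simp [avoidUpTo]
  rw [this]
  exact MeasurableSet.iInter fun i => MeasurableSet.iInter fun _ =>
    (measurable_pi_apply i) (Set.to_countable _).measurableSet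

theorem measurableSet_reach : MeasurableSet (reach A T) := by
  have : reach A T = ⋃ i, (fun ω : Run S A => ω i) ⁻¹' {z | z.1 ∈ T} := by
    ext ω
    simp [reach]
  rw [this]
  exact MeasurableSet.iUnion fun i => (measurable_pi_apply i) (Set.to_countable _).measurableSet

/-- The expected weight at time `n` of the runs that have not visited `T` up to then. -/
def avoidWeight (g : S × A → ENNReal) (n : ℕ) : ENNReal :=
  ∫⁻ ω in avoidUpTo A T n, g (ω n) ∂runMeasure σ ρ s₀

variable {T}

theorem avoidWeight_zero {g : S × A → ENNReal} (hg : ∀ z, z.1 ∈ T → g z = 0) :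
    avoidWeight σ ρ s₀ T g 0 = ∑ a, σ.act [] s₀ a * g (s₀, a) := by
  rw [← lintegral_runMeasure_zero σ ρ, avoidWeight,
    ← lintegral_indicator (measurableSet_avoidUpTo T 0)]
  refine lintegral_congr fun ω => ?_
  by_cases h : ω ∈ avoidUpTo A T 0
  · rw [Set.indicator_of_mem h]
  · rw [Set.indicator_of_notMem h]
    refine (hg _ ?_).symm
    by_contra hT
    exact h fun i hi => by rwa [Nat.le_zero.1 hi]

/-- Since `g` vanishes on `T`, the restriction at time `n + 1` is automatic. What remains depends
only on the prefix up to `n`, so one can condition on it. -/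
theorem avoidWeight_succ {g : S × A → ENNReal} (hg : ∀ z, z.1 ∈ T → g z = 0) (n : ℕ) :
    avoidWeight σ ρ s₀ T g (n + 1) =
      ∫⁻ ω in avoidUpTo A T n, ∑ z, stepPMF σ ρ n (Preorder.frestrictLe n ω) z * g z
        ∂runMeasure σ ρ s₀ := by
  classical
  have h := lintegral_runMeasure_succ σ ρ s₀ n fun x z => if ∀ i, (x i).1 ∉ T then g z else 0
  have hmem : ∀ ω : Run S A, (∀ i : Finset.Iic n, (Preorder.frestrictLe n ω i).1 ∉ T) ↔
      ω ∈ avoidUpTo A T n := fun ω =>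
    ⟨fun h i hi => h ⟨i, Finset.mem_Iic.2 hi⟩, fun h i => h i (Finset.mem_Iic.1 i.2)⟩
  rw [avoidWeight, ← lintegral_indicator (measurableSet_avoidUpTo T _),
    ← lintegral_indicator (measurableSet_avoidUpTo T _)]
  refine Eq.trans (lintegral_congr fun ω => ?_) (h.trans (lintegral_congr fun ω => ?_))
  · simp only [hmem, Set.indicator_apply]
    by_cases hω : ω ∈ avoidUpTo A T n
    · by_cases hT : (ω (n + 1)).1 ∈ T
      · simp [hg _ hT]
      · have : ω ∈ avoidUpTo A T (n + 1) := fun i hi => by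
          rcases Nat.le_succ_iff.1 hi with h | rfl
          exacts [hω i h, hT]
        simp [hω, this]
    · have : ω ∉ avoidUpTo A T (n + 1) := fun h => hω (antitone_avoidUpTo T n.le_succ h)
      simp [hω, this]
  · simp only [hmem, Set.indicator_apply]
    by_cases hω : ω ∈ avoidUpTo A T n <;> simp [hω]

theorem avoidWeight_succ_le {g : S × A → ENNReal} (hg : ∀ z, z.1 ∈ T → g z = 0) {θ : ENNReal}
    (h : ∀ h h' s a, s ∉ T →
      ∑ s', ρ.choose h s a s' * ∑ a', σ.act h' s' a' * g (s', a') ≤ θ * g (s, a)) (n : ℕ) :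
    avoidWeight σ ρ s₀ T g (n + 1) ≤ θ * avoidWeight σ ρ s₀ T g n := by
  rw [avoidWeight_succ σ ρ s₀ hg, avoidWeight,
    ← lintegral_const_mul (f := fun ω : Run S A => g (ω n)) _
      ((measurable_of_countable g).comp (measurable_pi_apply n))]
  refine setLIntegral_mono' (measurableSet_avoidUpTo T n) fun ω hω => ?_
  obtain ⟨h₁, h₂, heq⟩ := sum_stepPMF_mul σ ρ n (Preorder.frestrictLe n ω) g
  rw [heq]
  exact h h₁ h₂ _ _ (hω n le_rfl)

theorem le_avoidWeight_succ {g : S × A → ENNReal} (hg : ∀ z, z.1 ∈ T → g z = 0)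
    (h : ∀ h h' s a, s ∉ T →
      g (s, a) ≤ ∑ s', ρ.choose h s a s' * ∑ a', σ.act h' s' a' * g (s', a')) (n : ℕ) :
    avoidWeight σ ρ s₀ T g n ≤ avoidWeight σ ρ s₀ T g (n + 1) := by
  rw [avoidWeight_succ σ ρ s₀ hg, avoidWeight]
  refine setLIntegral_mono' (measurableSet_avoidUpTo T n) fun ω hω => ?_
  obtain ⟨h₁, h₂, heq⟩ := sum_stepPMF_mul σ ρ n (Preorder.frestrictLe n ω) g
  rw [heq]
  exact h h₁ h₂ _ _ (hω n le_rfl)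

/-- If a weight that is bounded below off `T` contracts in expectation, `T` is reached almost
surely. -/
theorem runMeasure_reach_eq_one {g : S × A → ENNReal} (hg : ∀ z, z.1 ∈ T → g z = 0)
    {c θ : ENNReal} (hc : c ≠ ⊤) (hgc : ∀ z, z.1 ∉ T → 1 ≤ c * g z) (hθ : θ < 1)
    (h : ∀ h h' s a, s ∉ T →
      ∑ s', ρ.choose h s a s' * ∑ a', σ.act h' s' a' * g (s', a') ≤ θ * g (s, a))
    (h0 : ∑ a, σ.act [] s₀ a * g (s₀, a) ≠ ⊤) :
    runMeasure σ ρ s₀ (reach A T) = 1 := by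
  rw [← prob_compl_eq_zero_iff (measurableSet_reach T)]
  set Φ := avoidWeight σ ρ s₀ T g with hΦ
  have hpow : ∀ n, Φ n ≤ θ ^ n * Φ 0 := fun n => by
    induction n with
    | zero => simp
    | succ n ih =>
      refine (avoidWeight_succ_le σ ρ s₀ hg h n).trans ?_
      rw [pow_succ', mul_assoc]
      gcongr
  have hle : ∀ n, runMeasure σ ρ s₀ (reach A T)ᶜ ≤ c * (θ ^ n * Φ 0) := fun n => by
    calc runMeasure σ ρ s₀ (reach A T)ᶜ ≤ runMeasure σ ρ s₀ (avoidUpTo A T n) := by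
          rw [compl_reach_eq_iInter]
          exact measure_mono (Set.iInter_subset _ n)
      _ = ∫⁻ _ in avoidUpTo A T n, 1 ∂runMeasure σ ρ s₀ := by simp
      _ ≤ ∫⁻ ω in avoidUpTo A T n, c * g (ω n) ∂runMeasure σ ρ s₀ :=
          setLIntegral_mono' (measurableSet_avoidUpTo T n) fun ω hω => hgc _ (hω n le_rfl)
      _ = c * Φ n :=
          lintegral_const_mul _ ((measurable_of_countable g).comp (measurable_pi_apply n))
      _ ≤ c * (θ ^ n * Φ 0) := by gcongr; exact hpow n
  have h0' : Φ 0 ≠ ⊤ := by rwa [hΦ, avoidWeight_zero σ ρ s₀ hg]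
  have hlim : Filter.Tendsto (fun n => c * (θ ^ n * Φ 0)) Filter.atTop (nhds 0) := by
    have h1 := ENNReal.Tendsto.mul_const (ENNReal.tendsto_pow_atTop_nhds_zero_of_lt_one hθ)
      (Or.inr h0')
    have h2 := ENNReal.Tendsto.const_mul (a := c) h1 (Or.inr hc)
    simpa using h2
  exact le_antisymm (ge_of_tendsto' hlim hle) bot_le

/-- If a weight bounded by one does not decrease in expectation, its initial expectation bounds the
probability of avoiding `T` from below. -/
theorem runMeasure_reach_le {g : S × A → ENNReal} (hg : ∀ z, z.1 ∈ T → g z = 0)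
    (hg1 : ∀ z, g z ≤ 1)
    (h : ∀ h h' s a, s ∉ T →
      g (s, a) ≤ ∑ s', ρ.choose h s a s' * ∑ a', σ.act h' s' a' * g (s', a')) :
    runMeasure σ ρ s₀ (reach A T) ≤ 1 - ∑ a, σ.act [] s₀ a * g (s₀, a) := by
  set Φ := avoidWeight σ ρ s₀ T g with hΦ
  have hmono : Monotone Φ := monotone_nat_of_le_succ (le_avoidWeight_succ σ ρ s₀ hg h)
  have hle : Φ 0 ≤ runMeasure σ ρ s₀ (reach A T)ᶜ := by
    rw [compl_reach_eq_iInter, (antitone_avoidUpTo T).measure_iInter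
      (fun n => (measurableSet_avoidUpTo T n).nullMeasurableSet) ⟨0, measure_ne_top _ _⟩]
    refine le_iInf fun n => (hmono n.zero_le).trans ?_
    calc Φ n ≤ ∫⁻ _ in avoidUpTo A T n, 1 ∂runMeasure σ ρ s₀ :=
          setLIntegral_mono' (measurableSet_avoidUpTo T n) fun ω _ => hg1 _
      _ = runMeasure σ ρ s₀ (avoidUpTo A T n) := by simp
  rw [← avoidWeight_zero σ ρ s₀ hg]
  have h1 := prob_compl_eq_one_sub (μ := runMeasure σ ρ s₀) (measurableSet_reach (A := A) T).compl
  rw [compl_compl] at h1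
  rw [h1]
  exact tsub_le_tsub_left hle 1

end RMDP

/-! ### Certificates and the values they imply -/

namespace RMDP

variable {S A : Type*}

/-- The pure memoryless policy that plays `f s` at `s`. -/
def purePolicy (M : RMDP S A) (f : S → A) (hf : ∀ s ∈ M.states, f s ∈ M.avail s) :
    M.AgentPolicy where
  act _ s := PMF.pure (f s)
  act_avail _ s hs a ha := by
    rcases eq_or_ne a (f s) with rfl | h
    · exact hf s hs
    · exact absurd (PMF.pure_apply_of_ne _ _ h) ha

variable [Fintype S]

theorem sum_pmf_eq_one (δ : PMF S) : ∑ t, δ t = 1 := by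
  rw [← δ.tsum_coe, tsum_fintype]

theorem sum_toReal_eq_one (δ : PMF S) : ∑ t, (δ t).toReal = 1 := by
  rw [← ENNReal.toReal_sum fun t _ => δ.apply_ne_top t, sum_pmf_eq_one,
    ENNReal.toReal_one]

/-- A certificate that from `R` the agent reaches `T` almost surely: there are a potential `u` and a
choice `f` of actions that keep the run in `R` and double the expected potential off `T`. -/
def AgentCert (M : RMDP S A) (T R : Finset S) : Prop :=
  ∃ (u : S → ℝ) (f : S → A), (∀ s, 0 ≤ u s) ∧ (∀ s, u s ≤ 1) ∧ (∀ s ∈ R, 0 < u s) ∧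
    ∀ s ∈ R, s ∉ T → f s ∈ M.avail s ∧ ∀ δ ∈ M.unc s (f s),
      (∀ t ∉ R, δ t = 0) ∧ 2 * u s ≤ ∑ t, (δ t).toReal * u t

/-- A certificate that from `U` the environment avoids `T` with positive probability: there are a
potential `w`, supported in `U`, and a choice `d` of distributions that do not decrease the expected
potential. -/
def EnvCert (M : RMDP S A) (T U : Finset S) : Prop :=
  U ⊆ M.states ∧ Disjoint U T ∧ ∃ (w : S → ENNReal) (d : S → A → PMF S),
    (∀ s, w s ≤ 1) ∧ (∀ s ∈ U, 0 < w s) ∧ (∀ s ∉ U, w s = 0) ∧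
    ∀ s ∈ U, ∀ a ∈ M.avail s, d s a ∈ M.unc s a ∧ w s ≤ ∑ t, d s a t * w t

variable {M : RMDP S A} {T R U : Finset S}

theorem AgentCert.of_makeAbsorbing (h : AgentCert (M.makeAbsorbing T) T R) : AgentCert M T R := by
  obtain ⟨u, f, h0, h1, hpos, hf⟩ := h
  refine ⟨u, f, h0, h1, hpos, fun s hs hsT => ?_⟩
  simpa [makeAbsorbing, hsT] using hf s hs hsT

theorem EnvCert.of_makeAbsorbing (h : EnvCert (M.makeAbsorbing T) T U) : EnvCert M T U := by
  obtain ⟨hU, hUT, w, d, hw1, hwpos, hw0, hd⟩ := h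
  refine ⟨hU, hUT, w, d, hw1, hwpos, hw0, fun s hs a ha => ?_⟩
  simpa [makeAbsorbing, Finset.disjoint_left.1 hUT hs] using hd s hs a ha

variable [Fintype A] [MeasurableSpace S] [MeasurableSingletonClass S]
  [MeasurableSpace A] [MeasurableSingletonClass A]

/-- An environment policy has to be exhibited: the infimum over an empty type would be `⊤`. -/
theorem val_le_one (O : Set (Run S A)) (s : S) : M.val O s ≤ 1 := by
  refine iSup_le fun σ => ?_
  have hs : ∀ s a, ∃ δ : PMF S, s ∈ M.states → a ∈ M.avail s → δ ∈ M.unc s a := fun s a => by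
    by_cases h : s ∈ M.states ∧ a ∈ M.avail s
    · obtain ⟨δ, hδ⟩ := M.unc_nonempty s h.1 a h.2
      exact ⟨δ, fun _ _ => hδ⟩
    · exact ⟨PMF.pure s, fun h₁ h₂ => absurd ⟨h₁, h₂⟩ h⟩
  choose d hd using hs
  exact (iInf_le _ (⟨fun _ => d, fun _ s hs a ha => hd s a hs ha⟩ : M.EnvPolicy)).trans prob_le_one

theorem AgentCert.exists_policy [Nonempty A] (hM : M.DeadlockFree) (hR : R ⊆ M.states)
    (h : AgentCert M T R) :
    ∃ σ : M.AgentPolicy, σ.Pure ∧ σ.Memoryless ∧ ∀ s ∈ R, valPolicy σ (reach A T) s = 1 := by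
  classical
  obtain ⟨u, f, hu0, hu1, hupos, hf⟩ := h
  have hf' : ∀ s, ∃ a, (s ∈ M.states → a ∈ M.avail s) ∧ (s ∈ R → s ∉ T → a = f s) := fun s => by
    by_cases hs : s ∈ R ∧ s ∉ T
    · exact ⟨f s, fun _ => (hf s hs.1 hs.2).1, fun _ _ => rfl⟩
    · by_cases hsM : s ∈ M.states
      · obtain ⟨a, ha⟩ := hM s hsM
        exact ⟨a, fun _ => ha, fun h₁ h₂ => absurd ⟨h₁, h₂⟩ hs⟩
      · exact ⟨Classical.arbitrary A, fun h => absurd h hsM, fun h₁ h₂ => absurd ⟨h₁, h₂⟩ hs⟩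
  choose f' hf'avail hf'eq using hf'
  -- The contraction factor will be `1 - m`. It must be nonzero, so that its product with `⊤` is
  -- `⊤`; halving the minimum ensures `m < 1`.
  obtain ⟨m, hm0, hm1, hmu⟩ : ∃ m : ℝ, 0 < m ∧ m < 1 ∧ ∀ s ∈ R, m ≤ u s := by
    rcases R.eq_empty_or_nonempty with rfl | hne
    · exact ⟨1 / 2, by norm_num, by norm_num, by simp⟩
    · obtain ⟨s₁, hs₁, hmin⟩ := R.exists_min_image u hne
      exact ⟨u s₁ / 2, by linarith [hupos s₁ hs₁], by linarith [hu1 s₁], fun s hs => by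
        linarith [hmin s hs, hupos s₁ hs₁]⟩
  have hstep : ∀ s ∈ R, s ∉ T → ∀ δ ∈ M.unc s (f s),
      ∑ t, (δ t).toReal * (1 - u t) ≤ 1 - 2 * u s := fun s hs hsT δ hδ => by
    have := ((hf s hs hsT).2 δ hδ).2
    simp only [mul_sub, mul_one, Finset.sum_sub_distrib, sum_toReal_eq_one]
    linarith
  -- Doubling a potential bounded by one forces `u ≤ 1/2` off `T`. Hence `1 - u ≥ 1/2` there, which
  -- is the constant `c = 2` below.
  have hhalf : ∀ s ∈ R, s ∉ T → u s ≤ 1 / 2 := fun s hs hsT => by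
    obtain ⟨δ, hδ⟩ := M.unc_nonempty s (hR hs) _ (hf s hs hsT).1
    have h1 := hstep s hs hsT δ hδ
    have h2 : 0 ≤ ∑ t, (δ t).toReal * (1 - u t) :=
      Finset.sum_nonneg fun t _ => mul_nonneg ENNReal.toReal_nonneg (by linarith [hu1 t])
    linarith
  refine ⟨M.purePolicy f' fun s hs => hf'avail s hs, fun _ s _ => ⟨_, rfl⟩, fun _ _ s _ => rfl,
    fun s₀ hs₀ => ?_⟩
  refine le_antisymm ((le_iSup (fun σ => valPolicy σ (reach A T) s₀) _).trans (val_le_one _ _))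
    (le_iInf fun ρ => ge_of_eq ?_)
  -- The drift condition is required at all pairs, including those the policy never produces. The
  -- value `⊤` makes it trivial there, and zero mass times `⊤` is zero.
  let g : S × A → ENNReal := fun z =>
    if z.1 ∈ T then 0 else if z.1 ∈ R ∧ z.2 = f z.1 then ENNReal.ofReal (1 - u z.1) else ⊤
  have hgR : ∀ s ∈ R, g (s, f' s) ≤ ENNReal.ofReal (1 - u s) := fun s hs => by
    by_cases hsT : s ∈ T
    · simp [g, hsT]
    · simp [g, hsT, hs, hf'eq s hs hsT]
  refine runMeasure_reach_eq_one _ ρ s₀ (g := g) (c := 2) (θ := ENNReal.ofReal (1 - m))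
    (fun z hz => by simp [g, hz]) (by simp) (fun z hz => ?_) ?_ (fun h h' s a hsT => ?_) ?_
  · simp only [g, hz, if_false]
    split_ifs with hc
    · rw [show (2 : ENNReal) = ENNReal.ofReal 2 by simp, ← ENNReal.ofReal_mul (by norm_num)]
      exact ENNReal.one_le_ofReal.2 (by linarith [hhalf _ hc.1 hz])
    · simp
  · rw [← ENNReal.ofReal_one]
    exact (ENNReal.ofReal_lt_ofReal_iff one_pos).2 (by linarith)
  · simp only [purePolicy, sum_pure_mul]
    by_cases hc : s ∈ R ∧ a = f s
    · obtain ⟨hs, rfl⟩ := hc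
      have hδ := ρ.choose_mem h s (hR hs) _ (hf s hs hsT).1
      have hgs : g (s, f s) = ENNReal.ofReal (1 - u s) := by simp [g, hsT, hs]
      rw [hgs, ← ENNReal.ofReal_mul (by linarith)]
      calc ∑ t, ρ.choose h s (f s) t * g (t, f' t)
          ≤ ∑ t, ENNReal.ofReal ((ρ.choose h s (f s) t).toReal * (1 - u t)) := by
            refine Finset.sum_le_sum fun t _ => ?_
            rw [ENNReal.ofReal_mul ENNReal.toReal_nonneg,
              ENNReal.ofReal_toReal (PMF.apply_ne_top _ _)]
            by_cases ht : t ∈ R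
            · exact mul_le_mul_right (hgR t ht) _
            · simp [((hf s hs hsT).2 _ hδ).1 t ht]
        _ = ENNReal.ofReal (∑ t, (ρ.choose h s (f s) t).toReal * (1 - u t)) :=
            (ENNReal.ofReal_sum_of_nonneg fun t _ =>
              mul_nonneg ENNReal.toReal_nonneg (by linarith [hu1 t])).symm
        _ ≤ ENNReal.ofReal ((1 - m) * (1 - u s)) := by
            refine ENNReal.ofReal_le_ofReal ((hstep s hs hsT _ hδ).trans ?_)
            -- The difference of the two sides is `u s - m + m * u s`, nonnegative as `m ≤ u s`.
            nlinarith [hmu s hs, hu0 s]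
    · have hgs : g (s, a) = ⊤ := by simp only [g, hsT, hc, if_false]
      rw [hgs, ENNReal.mul_top]
      · exact le_top
      · exact (ENNReal.ofReal_pos.2 (by linarith)).ne'
  · simp only [purePolicy, sum_pure_mul]
    exact ((hgR s₀ hs₀).trans_lt ENNReal.ofReal_lt_top).ne

theorem EnvCert.val_lt_one (h : EnvCert M T U) {s₀ : S} (hs₀ : s₀ ∈ U) :
    M.val (reach A T) s₀ < 1 := by
  classical
  obtain ⟨hU, hUT, w, d, hw1, hwpos, hw0, hd⟩ := h
  have hd' : ∀ s a, ∃ δ : PMF S, (s ∈ M.states → a ∈ M.avail s → δ ∈ M.unc s a) ∧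
      (s ∈ U → a ∈ M.avail s → δ = d s a) := fun s a => by
    by_cases hs : s ∈ U ∧ a ∈ M.avail s
    · exact ⟨d s a, fun _ _ => (hd s hs.1 a hs.2).1, fun _ _ => rfl⟩
    · by_cases h : s ∈ M.states ∧ a ∈ M.avail s
      · obtain ⟨δ, hδ⟩ := M.unc_nonempty s h.1 a h.2
        exact ⟨δ, fun _ _ => hδ, fun h₁ h₂ => absurd ⟨h₁, h₂⟩ hs⟩
      · exact ⟨PMF.pure s, fun h₁ h₂ => absurd ⟨h₁, h₂⟩ h, fun h₁ h₂ => absurd ⟨h₁, h₂⟩ hs⟩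
  choose d' hd'mem hd'eq using hd'
  let ρ : M.EnvPolicy := ⟨fun _ => d', fun _ s hs a ha => hd'mem s a hs ha⟩
  -- The certificate says nothing about unavailable actions, so they get weight zero. No agent
  -- policy plays them on `U`, so averaging over actions still gives `w`.
  let g : S × A → ENNReal := fun z => if z.2 ∈ M.avail z.1 then w z.1 else 0
  have hgσ : ∀ (σ : M.AgentPolicy) h s, ∑ a, σ.act h s a * g (s, a) = w s := fun σ h s => by
    by_cases hs : s ∈ U
    · calc ∑ a, σ.act h s a * g (s, a) = ∑ a, σ.act h s a * w s := by
            refine Finset.sum_congr rfl fun a _ => ?_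
            by_cases ha : a ∈ M.avail s
            · simp [g, ha]
            · rw [not_not.1 (mt (σ.act_avail h s (hU hs) a) ha), zero_mul, zero_mul]
        _ = w s := by
            rw [← Finset.sum_mul, sum_pmf_eq_one, one_mul]
    · simp [g, hw0 s hs]
  have hle : M.val (reach A T) s₀ ≤ 1 - w s₀ := by
    refine iSup_le fun σ => (iInf_le _ ρ).trans ?_
    rw [← hgσ σ [] s₀]
    refine runMeasure_reach_le σ ρ s₀ (fun z hz => ?_) (fun z => ?_) fun h h' s a _ => ?_
    · simp [g, hw0 _ (Finset.disjoint_right.1 hUT hz)]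
    · simp only [g]
      split_ifs
      exacts [hw1 _, zero_le_one]
    · simp only [hgσ]
      by_cases hs : s ∈ U
      · by_cases ha : a ∈ M.avail s
        · simpa [g, ha, ρ, hd'eq s a hs ha] using (hd s hs a ha).2
        · simp [g, ha]
      · simp [g, hw0 s hs]
  exact hle.trans_lt (ENNReal.sub_lt_self ENNReal.one_ne_top one_ne_zero (hwpos _ hs₀).ne')

end RMDP

/-! ### Termination and cost of oracle computations -/

namespace OracleComp

variable {α β S : Type*}

theorem returns_ret (a : α) : (ret a).Returns a 0 := Part.mem_some _

theorem Returns.andThen {x : OracleComp α} {f : α → OracleComp β} {a : α} {b : β} {m n : ℕ}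
    (hx : x.Returns a m) (hf : (f a).Returns b n) :
    (OracleComp.andThen x f).Returns b (m + n) :=
  Part.mem_bind hx (Part.mem_map (fun q : β × ℕ => (q.1, m + q.2)) hf)

open scoped Classical in
theorem returns_select (X : Finset S) (p : S → Prop) :
    ∃ F : Finset S, (∀ s, s ∈ F ↔ s ∈ X ∧ p s) ∧
      (select X fun s => query (p s)).Returns F X.card := by
  have key : ∀ l : List S, ∃ F : Finset S, (∀ s, s ∈ F ↔ s ∈ l ∧ p s) ∧
      Returns (l.foldr
        (fun s acc => OracleComp.andThen (query (p s)) fun b => OracleComp.andThen acc fun F =>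
          ret (if b then insert s F else F))
        (ret ∅)) F l.length := by
    intro l
    induction l with
    | nil => exact ⟨∅, by simp, returns_ret _⟩
    | cons s l ih =>
      obtain ⟨F, hF, hr⟩ := ih
      have h1 : (query (p s)).Returns (decide (p s)) 1 := Part.mem_some _
      refine ⟨if decide (p s) then insert s F else F, ?_, ?_⟩
      rotate_left
      · rw [List.foldr_cons, List.length_cons, add_comm]
        exact h1.andThen (f := fun b => OracleComp.andThen _ fun F =>
          ret (if b then insert s F else F)) (hr.andThen (returns_ret _))
      intro t
      by_cases hs : p s
      · simp only [hs, decide_true, if_true, Finset.mem_insert, hF, List.mem_cons]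
        constructor
        · rintro (rfl | h)
          exacts [⟨Or.inl rfl, hs⟩, ⟨Or.inr h.1, h.2⟩]
        · rintro ⟨rfl | h, h'⟩
          exacts [Or.inl rfl, Or.inr ⟨h, h'⟩]
      · simp only [hs, decide_false, Bool.false_eq_true, if_false, hF, List.mem_cons]
        constructor
        · exact fun h => ⟨Or.inr h.1, h.2⟩
        · rintro ⟨rfl | h, h'⟩
          exacts [absurd h' hs, ⟨h, h'⟩]
  obtain ⟨F, hF, hr⟩ := key X.toList
  refine ⟨F, fun s => by rw [hF, Finset.mem_toList], ?_⟩
  rw [Finset.length_toList] at hr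
  exact hr

/-- A loop whose body costs at most `c` calls, preserves `Inv`, and decreases `μ` when it does not
exit, terminates after at most `c * (μ a + 1)` calls. -/
theorem exists_returns_repeatUntil {body : α → OracleComp (β ⊕ α)} {Inv : α → Prop}
    {Post : β → Prop} {μ : α → ℕ} {c : ℕ}
    (h : ∀ a, Inv a → ∃ r n, (body a).Returns r n ∧ n ≤ c ∧
      Sum.elim Post (fun a' => Inv a' ∧ μ a' < μ a) r) {a : α} (ha : Inv a) :
    ∃ b n, (repeatUntil body a).Returns b n ∧ n ≤ c * (μ a + 1) ∧ Post b := by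
  -- The count `m` already accumulated is generalized, since the loop carries it along.
  have key : ∀ k a m, Inv a → μ a = k →
      ∃ b n, (b, m + n) ∈ PFun.fix (loopStep body) (a, m) ∧ n ≤ c * (k + 1) ∧ Post b := by
    intro k
    induction k using Nat.strong_induction_on with
    | _ k ih =>
      intro a m ha hk
      obtain ⟨r, n, hr, hn, hpost⟩ := h a ha
      have hstep := Part.mem_map (fun q : (β ⊕ α) × ℕ =>
        Sum.map (fun b => (b, m + q.2)) (fun a' => (a', m + q.2)) q.1) hr
      rcases r with b | a'
      · exact ⟨b, n, PFun.fix_stop hstep, hn.trans (Nat.le_mul_of_pos_right _ k.succ_pos), hpost⟩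
      · obtain ⟨ha', hlt⟩ := hpost
        obtain ⟨b, n', hb, hn', hpost⟩ := ih _ (hk ▸ hlt) a' (m + n) ha' rfl
        refine ⟨b, n + n', ?_, ?_, hpost⟩
        · rw [PFun.fix_fwd_eq hstep, ← add_assoc]
          exact hb
        · calc n + n' ≤ c + c * k :=
                add_le_add hn (hn'.trans (Nat.mul_le_mul_left c (hk ▸ hlt)))
            _ = c * (k + 1) := by ring
  obtain ⟨b, n, hb, hn, hpost⟩ := key _ a 0 ha rfl
  exact ⟨b, n, by rw [zero_add] at hb; exact hb, hn, hpost⟩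

end OracleComp

/-! ### Attractors and the growth of certificates -/

namespace RMDP

open OracleComp

variable {S A : Type*}

open scoped Classical in
-- The invariant is arbitrary so that both attractors can carry their certificates through the loop.
-- Each non-final pass adds a state, whence at most `M.states.card + 1` passes.
theorem exists_returns_attrLoop (M : RMDP S A) (force : S → Finset S → Prop) {T : Finset S}
    (hT : T ⊆ M.states) {Inv : Finset S → Prop} (h0 : Inv T)
    (hstep : ∀ T' F, T' ⊆ M.states → Inv T' → (∀ s ∈ F, s ∈ M.states ∧ force s T') →
      Inv (T' ∪ F)) :
    ∃ P n, (attrLoop M force T).Returns P n ∧ n ≤ M.states.card * (M.states.card + 1) ∧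
      P ⊆ M.states ∧ Inv P ∧ ∀ s ∈ M.states, force s P → s ∈ P := by
  obtain ⟨P, n, hr, hn, hpost⟩ := exists_returns_repeatUntil
    (body := fun T' => andThen (select M.states fun s => query (force s T')) fun F =>
      ret (if T' ∪ F = T' then Sum.inl (T' ∪ F) else Sum.inr (T' ∪ F)))
    (Inv := fun T' => T' ⊆ M.states ∧ Inv T')
    (Post := fun P => P ⊆ M.states ∧ Inv P ∧ ∀ s ∈ M.states, force s P → s ∈ P)
    (μ := fun T' => (M.states \ T').card) (c := M.states.card)
    (fun T' hT' => by
      obtain ⟨F, hF, hr⟩ := returns_select M.states fun s => force s T'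
      have hsub : T' ∪ F ⊆ M.states :=
        Finset.union_subset hT'.1 fun s hs => ((hF s).1 hs).1
      have hinv := hstep T' F hT'.1 hT'.2 fun s hs => (hF s).1 hs
      refine ⟨_, _, hr.andThen (returns_ret _), le_rfl, ?_⟩
      split_ifs with heq
      · refine ⟨hsub, hinv, fun s hs hf => ?_⟩
        rw [heq] at hf
        exact Finset.mem_union_right _ ((hF s).2 ⟨hs, hf⟩)
      · refine ⟨⟨hsub, hinv⟩, Finset.card_lt_card ?_⟩
        refine Finset.ssubset_iff_subset_ne.2
          ⟨Finset.sdiff_subset_sdiff le_rfl Finset.subset_union_left, fun h => heq ?_⟩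
        refine le_antisymm (fun s hs => ?_) Finset.subset_union_left
        by_contra hs'
        have : s ∈ M.states \ (T' ∪ F) := h ▸ Finset.mem_sdiff.2 ⟨hsub hs, hs'⟩
        exact (Finset.mem_sdiff.1 this).2 hs)
    (a := T) ⟨hT, h0⟩
  exact ⟨P, n, hr, hn.trans (Nat.mul_le_mul_left _
    (Nat.succ_le_succ (Finset.card_le_card Finset.sdiff_subset))), hpost⟩

theorem distMass_pos_iff {δ : PMF S} {B : Finset S} : 0 < distMass δ B ↔ ∃ t ∈ B, 0 < δ t := by
  rw [distMass, Finset.sum_pos_iff]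

theorem distMass_mono {δ : PMF S} {B C : Finset S} (h : B ⊆ C) (hB : 0 < distMass δ B) :
    0 < distMass δ C := by
  obtain ⟨t, ht, hpos⟩ := distMass_pos_iff.1 hB
  exact distMass_pos_iff.2 ⟨t, h ht, hpos⟩

theorem canStayIn_makeAbsorbing {M : RMDP S A} (hM : M.DeadlockFree) {T : Finset S}
    (hT : T ⊆ M.states) : (M.makeAbsorbing T).CanStayIn T := fun t ht => by
  obtain ⟨a, ha⟩ := hM t (hT ht)
  refine ⟨a, ha, fun δ hδ => ?_⟩
  have hδt : δ = PMF.pure t := by simpa [makeAbsorbing, ht] using hδ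
  rw [hδt, distMass, Finset.sum_eq_single t
    (fun s _ hs => PMF.pure_apply_of_ne _ _ hs) (fun h => absurd ht h), PMF.pure_apply_self]

variable [Fintype S]

theorem distMass_eq_zero_of_disjoint {δ : PMF S} {T B : Finset S} (hT : distMass δ T = 1)
    (h : Disjoint B T) : distMass δ B = 0 := by
  classical
  have h1 : distMass δ B + 1 ≤ 1 := by
    rw [← hT]
    nth_rw 2 [hT]
    rw [distMass, distMass, ← Finset.sum_union h, ← sum_pmf_eq_one δ]
    exact Finset.sum_le_sum_of_subset (Finset.subset_univ _)
  by_contra hne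
  have h2 : (1 : ENNReal) < distMass δ B + 1 :=
    add_comm (1 : ENNReal) _ ▸ ENNReal.lt_add_right ENNReal.one_ne_top hne
  exact absurd h1 (not_le.2 h2)

open scoped Classical in
-- Keep `w` on `U` and give all of `V \ U` one small constant `c`. If the chosen distribution hits
-- `U`, the old weight alone contributes at least `c`; otherwise it stays in `V \ U`, where the new
-- weight is constant.
theorem EnvCert.union [Fintype A] {M : RMDP S A} {T U V : Finset S} (h : EnvCert M T U)
    (hV : V ⊆ M.states) (hVT : Disjoint V T)
    (hstep : ∀ s ∈ V, ∀ a ∈ M.avail s, ∃ δ ∈ M.unc s a,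
      0 < distMass δ U ∨ ∀ t ∉ V, δ t = 0) : EnvCert M T (U ∪ V) := by
  obtain ⟨hU, hUT, w, d, hw1, hwpos, hw0, hd⟩ := h
  have he : ∀ s a, ∃ δ : PMF S, s ∈ V → a ∈ M.avail s →
      δ ∈ M.unc s a ∧ (0 < distMass δ U ∨ ∀ t ∉ V, δ t = 0) := fun s a => by
    by_cases hs : s ∈ V ∧ a ∈ M.avail s
    · obtain ⟨δ, hδ⟩ := hstep s hs.1 a hs.2
      exact ⟨δ, fun _ _ => hδ⟩
    · exact ⟨PMF.pure s, fun h₁ h₂ => absurd ⟨h₁, h₂⟩ hs⟩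
  choose e he using he
  -- The default 1 makes pairs that do not hit `U` harmless in the minimum, which is then positive
  -- by finiteness.
  let b : S × A → ENNReal := fun p =>
    if 0 < distMass (e p.1 p.2) U then ∑ t, e p.1 p.2 t * w t else 1
  let c : ENNReal := Finset.univ.inf b ⊓ 1
  have hc0 : 0 < c := by
    refine lt_inf_iff.2 ⟨(Finset.lt_inf_iff ENNReal.zero_lt_top).2 fun p _ => ?_, one_pos⟩
    simp only [b]
    split_ifs with hp
    · obtain ⟨t, ht, hpos⟩ := distMass_pos_iff.1 hp
      exact (ENNReal.mul_pos hpos.ne' (hwpos t ht).ne').trans_le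
        (Finset.single_le_sum (f := fun t => e p.1 p.2 t * w t) (fun _ _ => zero_le)
          (Finset.mem_univ t))
    · exact one_pos
  have hcb : ∀ s a, 0 < distMass (e s a) U → c ≤ ∑ t, e s a t * w t := fun s a hp => by
    have : c ≤ b (s, a) := inf_le_left.trans (Finset.inf_le (Finset.mem_univ _))
    simpa [b, hp] using this
  let w' : S → ENNReal := fun s => if s ∈ U then w s else if s ∈ V then c else 0
  have hww' : ∀ s, w s ≤ w' s := fun s => by
    by_cases hs : s ∈ U
    · simp [w', hs]
    · simp [hw0 s hs]
  refine ⟨Finset.union_subset hU hV, Finset.disjoint_union_left.2 ⟨hUT, hVT⟩, w',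
    fun s a => if s ∈ U then d s a else e s a, fun s => ?_, fun s hs => ?_, fun s hs => ?_,
    fun s hs a ha => ?_⟩
  · simp only [w']
    split_ifs
    exacts [hw1 s, inf_le_right, zero_le]
  · simp only [w']
    split_ifs with h₁ h₂
    · exact hwpos s h₁
    · exact hc0
    · exact absurd hs (by simp [h₁, h₂])
  · rw [Finset.mem_union, not_or] at hs
    simp [w', hs.1, hs.2]
  · by_cases hsU : s ∈ U
    · have h1 := hd s hsU a ha
      simp only [w', hsU, if_true]
      exact ⟨h1.1, h1.2.trans (Finset.sum_le_sum fun t _ => mul_le_mul_right (hww' t) _)⟩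
    · have hsV : s ∈ V := (Finset.mem_union.1 hs).resolve_left hsU
      have h1 := he s a hsV ha
      have hw's : w' s = c := by simp [w', hsU, hsV]
      simp only [hsU, if_false]
      refine ⟨h1.1, hw's.trans_le ?_⟩
      by_cases hp : 0 < distMass (e s a) U
      · exact (hcb s a hp).trans (Finset.sum_le_sum fun t _ => mul_le_mul_right (hww' t) _)
      · have hsupp := h1.2.resolve_left hp
        refine le_of_eq ?_
        calc c = ∑ t, e s a t * c := by rw [← Finset.sum_mul, sum_pmf_eq_one, one_mul]
          _ = ∑ t, e s a t * w' t := by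
            refine Finset.sum_congr rfl fun t _ => ?_
            by_cases ht : t ∈ V
            · by_cases htU : t ∈ U
              · have h0 : e s a t = 0 := by
                  by_contra hne
                  exact hp (distMass_pos_iff.2 ⟨t, htU, pos_iff_ne_zero.2 hne⟩)
                rw [h0, zero_mul, zero_mul]
              · simp [w', ht, htU]
            · rw [hsupp t ht, zero_mul, zero_mul]

/-- The expectation is continuous in the distribution and attains its minimum on the compact
uncertainty set. -/
theorem exists_pos_le_sum {M : RMDP S A} {s : S} (hs : s ∈ M.states) {a : A} (ha : a ∈ M.avail s)
    {u : S → ℝ} (hpos : ∀ δ ∈ M.unc s a, 0 < ∑ t, (δ t).toReal * u t) :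
    ∃ m > 0, ∀ δ ∈ M.unc s a, m ≤ ∑ t, (δ t).toReal * u t := by
  obtain ⟨_, ⟨δ₀, hδ₀, rfl⟩, hmin⟩ := (M.unc_compact s hs a ha).exists_isMinOn
    ((M.unc_nonempty s hs a ha).image _) (f := fun x : S → ℝ => ∑ t, x t * u t)
    (by fun_prop)
  exact ⟨_, hpos δ₀ hδ₀, fun δ hδ => isMinOn_iff.1 hmin _ ⟨δ, hδ, rfl⟩⟩

/-- A potential supported in `P` witnessing that in `P` the agent can force a positive
probability of reaching `T` within `P`. -/
def AttrCert (M : RMDP S A) (T P : Finset S) : Prop :=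
  ∃ u : S → ℝ, (∀ s, 0 ≤ u s) ∧ (∀ s, u s ≤ 1) ∧ (∀ s ∈ P, 0 < u s) ∧ (∀ s ∉ P, u s = 0) ∧
    ∀ s ∈ P, s ∉ T → ∃ a ∈ M.avail s, ∀ δ ∈ M.unc s a, 2 * u s ≤ ∑ t, (δ t).toReal * u t

theorem attrCert_self (M : RMDP S A) (T : Finset S) : AttrCert M T T := by
  classical
  exact ⟨fun s => if s ∈ T then 1 else 0, fun s => by dsimp only; split_ifs <;> norm_num,
    fun s => by dsimp only; split_ifs <;> norm_num, fun s hs => by simp [hs],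
    fun s hs => by simp [hs],
    fun s hs hs' => absurd hs hs'⟩

open scoped Classical in
-- Forcing `P` gives each new state an expected potential bounded below uniformly over the
-- environment's choices. Half the least of these bounds, capped at one, is the weight of the new
-- layer.
theorem AttrCert.union {M : RMDP S A} {T P F : Finset S} (h : AttrCert M T P)
    (hF : ∀ s ∈ F, s ∈ M.states ∧ M.forceA s P) : AttrCert M T (P ∪ F) := by
  obtain ⟨u, hu0, hu1, hupos, huz, hu⟩ := h
  have hm : ∀ s ∈ F, ∃ m > 0, ∃ a ∈ M.avail s, ∀ δ ∈ M.unc s a,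
      m ≤ ∑ t, (δ t).toReal * u t := fun s hs => by
    obtain ⟨hsM, a, ha, hδ⟩ := hF s hs
    obtain ⟨m, hm, hle⟩ := exists_pos_le_sum hsM ha (u := u) fun δ hδ' => by
      obtain ⟨t, ht, hpos⟩ := distMass_pos_iff.1 (hδ δ hδ')
      exact Finset.sum_pos' (fun t _ => mul_nonneg ENNReal.toReal_nonneg (hu0 t))
        ⟨t, Finset.mem_univ t,
          mul_pos (ENNReal.toReal_pos hpos.ne' (δ.apply_ne_top t)) (hupos t ht)⟩
    exact ⟨m, hm, a, ha, hle⟩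
  choose! m hm0 hm using hm
  obtain ⟨c, hc0, hc1, hcm⟩ : ∃ c : ℝ, 0 < c ∧ c ≤ 1 ∧ ∀ s ∈ F, 2 * c ≤ m s := by
    rcases F.eq_empty_or_nonempty with rfl | hne
    · exact ⟨1, one_pos, le_rfl, by simp⟩
    · obtain ⟨s₁, hs₁, hmin⟩ := F.exists_min_image m hne
      refine ⟨min 1 (m s₁ / 2), lt_min one_pos (half_pos (hm0 s₁ hs₁)), min_le_left _ _,
        fun s hs => ?_⟩
      linarith [hmin s hs, min_le_right 1 (m s₁ / 2)]
  let u' : S → ℝ := fun s => if s ∈ P then u s else if s ∈ F then c else 0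
  have huu' : ∀ s, u s ≤ u' s := fun s => by
    by_cases hs : s ∈ P
    · simp [u', hs]
    · simp only [u', hs, if_false, huz s hs]
      split_ifs
      exacts [hc0.le, le_rfl]
  have hsum : ∀ δ : PMF S, ∑ t, (δ t).toReal * u t ≤ ∑ t, (δ t).toReal * u' t := fun δ =>
    Finset.sum_le_sum fun t _ => mul_le_mul_of_nonneg_left (huu' t) ENNReal.toReal_nonneg
  refine ⟨u', fun s => (hu0 s).trans (huu' s), fun s => ?_, fun s hs => ?_, fun s hs => ?_,
    fun s hs hsT => ?_⟩
  · simp only [u']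
    split_ifs
    exacts [hu1 s, hc1, zero_le_one]
  · simp only [u']
    split_ifs with h₁ h₂
    · exact hupos s h₁
    · exact hc0
    · exact absurd hs (by simp [h₁, h₂])
  · rw [Finset.mem_union, not_or] at hs
    simp [u', hs.1, hs.2]
  · by_cases hsP : s ∈ P
    · obtain ⟨a, ha, hle⟩ := hu s hsP hsT
      refine ⟨a, ha, fun δ hδ => le_trans ?_ ((hle δ hδ).trans (hsum δ))⟩
      simp [u', hsP]
    · have hsF : s ∈ F := (Finset.mem_union.1 hs).resolve_left hsP
      obtain ⟨a, ha, hle⟩ := hm s hsF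
      refine ⟨a, ha, fun δ hδ => le_trans ?_ ((hle δ hδ).trans (hsum δ))⟩
      simpa [u', hsP, hsF] using hcm s hsF

end RMDP

/-! ### Invariant and correctness of `asReach` -/

namespace RMDP

open OracleComp

variable {S A : Type*} [Fintype S]

/-- The invariant of `asReach`: `N` is a deadlock-free sub-RMDP of `M`, and if the agent can stay in
`T`, the environment can avoid `T` from the removed states and can reach them with positive
probability after a removed action. -/
def IsReduct [DecidableEq S] (M : RMDP S A) (T : Finset S) (N : RMDP S A) : Prop :=
  N.states ⊆ M.states ∧ N.unc = M.unc ∧ (∀ s ∈ N.states, N.avail s ⊆ M.avail s) ∧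
    N.DeadlockFree ∧ (M.CanStayIn T → T ⊆ N.states ∧ N.CanStayIn T ∧
      EnvCert M T (M.states \ N.states) ∧ ∀ s ∈ N.states, ∀ a ∈ M.avail s, a ∉ N.avail s →
        ∃ δ ∈ M.unc s a, 0 < distMass δ (M.states \ N.states))

open scoped Classical in
theorem isReduct_self {M : RMDP S A} (hM : M.DeadlockFree) {T : Finset S} (hT : T ⊆ M.states) :
    IsReduct M T M := by
  refine ⟨le_rfl, rfl, fun _ _ => le_rfl, hM, fun h => ⟨hT, h, ?_, fun s _ a ha ha' =>
    absurd ha ha'⟩⟩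
  rw [sdiff_self]
  exact ⟨by simp, by simp, 0, fun s _ => PMF.pure s, by simp, by simp, by simp, by simp⟩

open scoped Classical in
-- The certificate must answer all actions of `M`. Against an action missing in `N`, the environment
-- moves to an already removed state with positive probability.
theorem IsReduct.envCert_union [Fintype A] {M N : RMDP S A} {T Z F : Finset S}
    (h : IsReduct M T N) (hstay : M.CanStayIn T) (hZ : EnvCert M T (M.states \ N.states ∪ Z))
    (hF : ∀ s ∈ F, s ∈ N.states) (hFT : Disjoint F T)
    (hstep : ∀ s ∈ F, ∀ a ∈ N.avail s, ∃ δ ∈ N.unc s a,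
      0 < distMass δ Z ∨ ∀ t ∉ F, δ t = 0) :
    EnvCert M T (M.states \ N.states ∪ (Z ∪ F)) := by
  obtain ⟨hsub, hunc, -, -, hinv⟩ := h
  obtain ⟨-, -, -, hrem⟩ := hinv hstay
  rw [← Finset.union_assoc]
  refine hZ.union (fun s hs => hsub (hF s hs)) hFT fun s hs a ha => ?_
  by_cases haN : a ∈ N.avail s
  · obtain ⟨δ, hδ, hc⟩ := hstep s hs a haN
    exact ⟨δ, hunc ▸ hδ, hc.imp_left (distMass_mono Finset.subset_union_right)⟩
  · obtain ⟨δ, hδ, hc⟩ := hrem s (hF s hs) a ha haN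
    exact ⟨δ, hδ, Or.inl (distMass_mono Finset.subset_union_left hc)⟩

open scoped Classical in
-- Closure of `Z` under `forceE` leaves every surviving state an action that surely avoids `Z`, so
-- no deadlock arises.
theorem IsReduct.remove {M N : RMDP S A} {T Z : Finset S} (h : IsReduct M T N)
    (hZN : Z ⊆ N.states) (hclosed : ∀ s ∈ N.states, N.forceE s Z → s ∈ Z)
    (hcert : M.CanStayIn T → Disjoint Z T ∧ EnvCert M T (M.states \ N.states ∪ Z)) :
    IsReduct M T (N.remove Z) := by
  obtain ⟨hsub, hunc, hav, hdf, hinv⟩ := h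
  refine ⟨Finset.sdiff_subset.trans hsub, hunc, fun s hs => (Finset.filter_subset _ _).trans
    (hav s (Finset.mem_sdiff.1 hs).1), fun s hs => ?_, fun hstay => ?_⟩
  · obtain ⟨hsN, hsZ⟩ := Finset.mem_sdiff.1 hs
    have hnf := mt (hclosed s hsN) hsZ
    simp only [forceE, not_forall, not_exists, not_and, not_lt, nonpos_iff_eq_zero] at hnf
    obtain ⟨a, ha, hδ⟩ := hnf
    exact ⟨a, Finset.mem_filter.2 ⟨ha, hδ⟩⟩
  · obtain ⟨hTN, hstayN, -, hrem⟩ := hinv hstay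
    obtain ⟨hZT, hZcert⟩ := hcert hstay
    have hU : M.states \ (N.remove Z).states = M.states \ N.states ∪ Z := by
      simp only [RMDP.remove]
      rw [sdiff_sdiff_right', Finset.inf_eq_inter, Finset.sup_eq_union,
        Finset.inter_eq_right.2 (hZN.trans hsub)]
    rw [hU]
    refine ⟨fun t ht => Finset.mem_sdiff.2 ⟨hTN ht, Finset.disjoint_right.1 hZT ht⟩,
      fun t ht => ?_, hZcert, fun s hs a ha ha' => ?_⟩
    · obtain ⟨a, ha, hδ⟩ := hstayN t ht
      exact ⟨a, Finset.mem_filter.2 ⟨ha, fun δ h => distMass_eq_zero_of_disjoint (hδ δ h) hZT⟩, hδ⟩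
    · by_cases haN : a ∈ N.avail s
      · have hne : ¬ ∀ δ ∈ N.unc s a, distMass δ Z = 0 := fun h =>
          ha' (Finset.mem_filter.2 ⟨haN, h⟩)
        push Not at hne
        obtain ⟨δ, hδ, hpos⟩ := hne
        exact ⟨δ, hunc ▸ hδ, distMass_mono Finset.subset_union_right (pos_iff_ne_zero.2 hpos)⟩
      · obtain ⟨δ, hδ, hpos⟩ := hrem s (Finset.mem_sdiff.1 hs).1 a ha haN
        exact ⟨δ, hδ, distMass_mono Finset.subset_union_left hpos⟩

open scoped Classical in
theorem IsReduct.agentCert [Nonempty A] {M N : RMDP S A} {T : Finset S} (h : IsReduct M T N)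
    (hP : AttrCert N (T ∩ N.states) N.states) : AgentCert M T N.states := by
  obtain ⟨-, hunc, hav, -, -⟩ := h
  obtain ⟨u, hu0, hu1, hupos, -, hu⟩ := hP
  have hf : ∀ s ∈ N.states, s ∉ T → ∃ a ∈ N.avail s, ∀ δ ∈ N.unc s a,
      2 * u s ≤ ∑ t, (δ t).toReal * u t := fun s hs hsT =>
    hu s hs fun h => hsT (Finset.mem_inter.1 h).1
  choose! f hf using hf
  refine ⟨u, f, hu0, hu1, hupos, fun s hs hsT => ?_⟩
  obtain ⟨ha, hδ⟩ := hf s hs hsT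
  exact ⟨hav s hs ha, fun δ h =>
    ⟨N.unc_support s hs _ ha δ (hunc ▸ h), hδ δ (hunc ▸ h)⟩⟩

open scoped Classical in
theorem IsReduct.exists_pAttrE [Fintype A] {M N : RMDP S A} {T P : Finset S}
    (h : IsReduct M T N) (hTP : T ∩ N.states ⊆ P)
    (hclosed : ∀ s ∈ N.states, N.forceA s P → s ∈ P) :
    ∃ Z n, (pAttrE N (N.states \ P)).Returns Z n ∧ n ≤ N.states.card * (N.states.card + 1) ∧
      Z ⊆ N.states ∧ (∀ s ∈ N.states, N.forceE s Z → s ∈ Z) ∧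
      N.states \ P ⊆ Z ∧ (N.states \ P = ∅ → Z = ∅) ∧
      (M.CanStayIn T → Disjoint Z T ∧ EnvCert M T (M.states \ N.states ∪ Z)) := by
  have hBT : Disjoint (N.states \ P) T := Finset.disjoint_left.2 fun s hs hsT =>
    (Finset.mem_sdiff.1 hs).2 (hTP (Finset.mem_inter.2 ⟨hsT, (Finset.mem_sdiff.1 hs).1⟩))
  obtain ⟨Z, n, hr, hn, hZN, ⟨hBZ, hZe, hZc⟩, hcl⟩ := exists_returns_attrLoop N N.forceE
    (T := N.states \ P) Finset.sdiff_subset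
    (Inv := fun Z => N.states \ P ⊆ Z ∧ (N.states \ P = ∅ → Z = ∅) ∧
      (M.CanStayIn T → Disjoint Z T ∧ EnvCert M T (M.states \ N.states ∪ Z)))
    ⟨le_rfl, id, fun hstay => ⟨hBT, by
      have hcert : EnvCert M T (M.states \ N.states ∪ ∅) := by
        rw [Finset.union_empty]
        exact (h.2.2.2.2 hstay).2.2.1
      -- Outside the closed set `P`, each action in `N` admits a distribution without mass on `P`,
      -- so the environment can confine the play to `N.states \ P`.
      have := h.envCert_union (F := N.states \ P) hstay hcert
        (fun s hs => (Finset.mem_sdiff.1 hs).1) hBT fun s hs a ha => by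
          obtain ⟨hsN, hsP⟩ := Finset.mem_sdiff.1 hs
          have hnf := mt (hclosed s hsN) hsP
          simp only [forceA, not_exists, not_and, not_forall, not_lt, nonpos_iff_eq_zero] at hnf
          obtain ⟨δ, hδ, h0⟩ := hnf a ha
          refine ⟨δ, hδ, Or.inr fun t ht => ?_⟩
          by_cases htN : t ∈ N.states
          · have htP : t ∈ P := by
              by_contra htP
              exact ht (Finset.mem_sdiff.2 ⟨htN, htP⟩)
            exact Finset.sum_eq_zero_iff.1 h0 t htP
          · exact N.unc_support s hsN a ha δ hδ t htN
      rwa [Finset.empty_union] at this⟩⟩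
    (fun Z F hZN ⟨hBZ, hZe, hZc⟩ hF => by
      refine ⟨hBZ.trans Finset.subset_union_left, fun hB => ?_, fun hstay => ?_⟩
      · rw [hZe hB, Finset.empty_union, Finset.eq_empty_iff_forall_notMem]
        intro s hs
        obtain ⟨hsN, hfs⟩ := hF s hs
        -- Without an available action `forceE` would hold vacuously, even for the empty set.
        obtain ⟨a, ha⟩ := h.2.2.2.1 s hsN
        obtain ⟨δ, -, hpos⟩ := hfs a ha
        simp [hZe hB, distMass] at hpos
      · obtain ⟨hZT, hcert⟩ := hZc hstay
        -- An action that stays in `T` gives `Z` no mass, so the environment's attractor never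
        -- absorbs a target.
        have hFT : Disjoint F T := Finset.disjoint_left.2 fun s hs hsT => by
          obtain ⟨a, ha, hδ⟩ := (h.2.2.2.2 hstay).2.1 s hsT
          obtain ⟨δ, hδ', hpos⟩ := (hF s hs).2 a ha
          exact hpos.ne' (distMass_eq_zero_of_disjoint (hδ δ hδ') hZT)
        refine ⟨Finset.disjoint_union_left.2 ⟨hZT, hFT⟩,
          h.envCert_union hstay hcert (fun s hs => (hF s hs).1) hFT fun s hs a ha => ?_⟩
        obtain ⟨δ, hδ, hpos⟩ := (hF s hs).2 a ha
        exact ⟨δ, hδ, Or.inl hpos⟩)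
  exact ⟨Z, n, hr, hn, hZN, hcl, hBZ, hZe, hZc⟩

open scoped Classical in
theorem exists_returns_asReach [Fintype A] [Nonempty A] {M : RMDP S A} (hM : M.DeadlockFree)
    {T : Finset S} (hT : T ⊆ M.states) :
    ∃ R n, (M.asReach T).Returns R n ∧ n ≤ 8 * M.states.card ^ 3 ∧ R ⊆ M.states ∧
      AgentCert M T R ∧ (M.CanStayIn T → EnvCert M T (M.states \ R)) := by
  obtain ⟨R, n, hr, hn, hpost⟩ := exists_returns_repeatUntil
    (body := fun N : RMDP S A => andThen (pAttrA N (T ∩ N.states)) fun P =>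
      andThen (pAttrE N (N.states \ P)) fun Z =>
        ret (if N.states \ P = ∅ then Sum.inl (N.remove Z).states else Sum.inr (N.remove Z)))
    (Inv := IsReduct M T)
    (Post := fun R => R ⊆ M.states ∧ AgentCert M T R ∧
      (M.CanStayIn T → EnvCert M T (M.states \ R)))
    -- A round costs two attractor computations, and every non-final round removes a state.
    (μ := fun N => N.states.card) (c := 2 * (M.states.card * (M.states.card + 1)))
    (fun N hN => by
      obtain ⟨P, n₁, hr₁, hn₁, hPN, ⟨hTP, hPcert⟩, hPcl⟩ := exists_returns_attrLoop N N.forceA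
        (T := T ∩ N.states) Finset.inter_subset_right
        (Inv := fun P => T ∩ N.states ⊆ P ∧ AttrCert N (T ∩ N.states) P)
        ⟨le_rfl, attrCert_self _ _⟩
        fun P F _ hP hF => ⟨hP.1.trans Finset.subset_union_left, hP.2.union hF⟩
      obtain ⟨Z, n₂, hr₂, hn₂, hZN, hZcl, hBZ, hZe, hZc⟩ := hN.exists_pAttrE hTP hPcl
      have hN' := hN.remove hZN hZcl hZc
      have hcard : N.states.card * (N.states.card + 1) ≤
          M.states.card * (M.states.card + 1) :=
        Nat.mul_le_mul (Finset.card_le_card hN.1) (Nat.succ_le_succ (Finset.card_le_card hN.1))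
      refine ⟨_, _, hr₁.andThen (hr₂.andThen (returns_ret _)), by omega, ?_⟩
      split_ifs with hB
      · have hst : (N.remove Z).states = N.states := by simp [RMDP.remove, hZe hB]
        have hPeq : P = N.states := le_antisymm hPN (Finset.sdiff_eq_empty_iff_subset.1 hB)
        refine ⟨hN'.1, ?_, fun hstay => (hN'.2.2.2.2 hstay).2.2.1⟩
        rw [hst]
        exact hN.agentCert (by rwa [hPeq] at hPcert)
      · obtain ⟨s, hs⟩ := Finset.nonempty_iff_ne_empty.2 hB
        exact ⟨hN', Finset.card_lt_card (Finset.sdiff_ssubset hZN ⟨s, hBZ hs⟩)⟩)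
    (a := M) (isReduct_self hM hT)
  refine ⟨R, n, hr, hn.trans ?_, hpost⟩
  generalize M.states.card = k
  rcases k.eq_zero_or_pos with rfl | hk
  · simp
  · calc 2 * (k * (k + 1)) * (k + 1) ≤ 2 * (k * (k + k)) * (k + k) := by gcongr <;> omega
      _ = 8 * k ^ 3 := by ring

variable [Fintype A] [MeasurableSpace S] [MeasurableSingletonClass S]
  [MeasurableSpace A] [MeasurableSingletonClass A] {M : RMDP S A} {T R : Finset S} {s : S}

theorem AgentCert.val_eq_one [Nonempty A] (h : AgentCert M T R) (hM : M.DeadlockFree)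
    (hR : R ⊆ M.states) (hs : s ∈ R) : M.val (reach A T) s = 1 := by
  obtain ⟨σ, -, -, hσ⟩ := h.exists_policy hM hR
  refine le_antisymm (val_le_one _ _) ?_
  rw [← hσ _ hs]
  exact le_iSup (fun σ => valPolicy σ (reach A T) _) σ

open scoped Classical in
theorem EnvCert.mem_of_val_eq_one (h : EnvCert M T (M.states \ R)) (hs : s ∈ M.states)
    (hv : M.val (reach A T) s = 1) : s ∈ R := by
  by_contra hsR
  exact (h.val_lt_one (Finset.mem_sdiff.2 ⟨hs, hsR⟩)).ne hv

end RMDP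

end

theorem mainTheorem1 :
    ∃ C : ℕ, ∀ (S A : Type*) [Fintype S] [Fintype A] [Nonempty A]
      [MeasurableSpace S] [MeasurableSingletonClass S]
      [MeasurableSpace A] [MeasurableSingletonClass A]
      (M : RMDP S A) (_ : M.DeadlockFree) (T : Finset S) (_ : T ⊆ M.states),
      -- the algorithm on `M`: termination, number of oracle calls, soundness, correctness
      (∃ (R : Finset S) (n : ℕ), (M.asReach T).Returns R n ∧ n ≤ C * M.states.card ^ 3 ∧
        R ⊆ M.states ∧
        (∀ s ∈ R, M.val (RMDP.reach A T) s = 1) ∧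
        (M.CanStayIn T → ∀ s ∈ M.states, M.val (RMDP.reach A T) s = 1 ↔ s ∈ R)) ∧
      -- arbitrary targets: correctness of the algorithm after making the targets absorbing
      (∃ (R : Finset S) (n : ℕ), ((M.makeAbsorbing T).asReach T).Returns R n ∧
        n ≤ C * M.states.card ^ 3 ∧
        R ⊆ M.states ∧
        ∀ s ∈ M.states, M.val (RMDP.reach A T) s = 1 ↔ s ∈ R) ∧
      -- almost-sure and limit-sure reachability coincide, with one pure memoryless policy
      (∃ σ : M.AgentPolicy, σ.Pure ∧ σ.Memoryless ∧
        ∀ s ∈ M.states,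
          (M.val (RMDP.reach A T) s = 1 ↔ RMDP.valPolicy σ (RMDP.reach A T) s = 1)) := by
  refine ⟨8, fun S A _ _ _ _ _ _ _ M hM T hT => ?_⟩
  obtain ⟨R, n, hr, hn, hR, hagent, henv⟩ := RMDP.exists_returns_asReach hM hT
  have hMT : (M.makeAbsorbing T).DeadlockFree := hM
  obtain ⟨R', n', hr', hn', hR', hagent', henv'⟩ := RMDP.exists_returns_asReach hMT hT
  have hagentM := hagent'.of_makeAbsorbing
  have henvM := (henv' (RMDP.canStayIn_makeAbsorbing hM hT)).of_makeAbsorbing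
  refine ⟨⟨R, n, hr, hn, hR, fun s hs => hagent.val_eq_one hM hR hs, fun h s hs =>
    ⟨(henv h).mem_of_val_eq_one hs, hagent.val_eq_one hM hR⟩⟩, ⟨R', n', hr', hn', hR', fun s hs =>
    ⟨henvM.mem_of_val_eq_one hs, hagentM.val_eq_one hM hR'⟩⟩, ?_⟩
  -- The policy comes from `R'`, since `R` can miss states of value one when targets cannot be kept.
  obtain ⟨σ, hpure, hmem, hσ⟩ := hagentM.exists_policy hM hR'
  refine ⟨σ, hpure, hmem, fun s hs => ⟨fun hv => hσ s (henvM.mem_of_val_eq_one hs hv),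
    fun hv => ?_⟩⟩
  refine le_antisymm (RMDP.val_le_one _ _) ?_
  rw [← hv]
  exact le_iSup (fun σ => RMDP.valPolicy σ (RMDP.reach A T) s) σ
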